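/- Let $r\ge 2$ be an integer. Let $v_1$ be the characteristic function of $[-\tfrac12,\tfrac12]$ and let $v_r$ be the convolution of $v_1$ with itself $r-1$ times. For an integer $N\ge 4r$ put $h=1/N$, $$\phi_l(x)=v_r\Bigl(h^{-1}x-l-\tfrac{r-2}{2}\Bigr)\quad(l\in\mathbb Z),\qquad \Phi_j(x)=\sum_{l\in\mathbb Z}\phi_{j+lN}(x)\quad(j=1,\dots,N),$$ so that the restrictions of $\Phi_1,\dots,\Phi_N$ to $[0,1]$ are the standard B-spline basis of the smooth $1$-periodic splines of order $r$ on the uniform mesh of width $h$. Let $G$ be the $N\times N$ Gram matrix $$G_{ij}=h^{-1}\int_0^1\Phi_j(x)\Phi_i(x)\,dx,\qquad 1\le i,j\le N.$$ Then there exist constants $C_1,C_2,C_3>0$ and $q>1$, depending on $r$ but independent of $N$, such that for every $N\ge 4r$ the matrix $G$ is invertible and, if $\gamma=(\gamma_1,\dots,\gamma_N)$ is the first row of $\Gamma=G^{-1}$, then $$|\gamma_i|\le C_1q^{-(i-1)}+C_2q^{-(N-i)}\qquad\text{for } i=r,r+1,\dots,\lfloor N/2\rfloor+1,$$ and $$\sum_{i=r}^{\lfloor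 N/2\rfloor+1}(1+i)\,|\gamma_i|\le C_3.$$ -/

import Mathlib

open MeasureTheory

noncomputable section

/-- The characteristic function `v_1` of `[-1/2, 1/2]`. -/
def boxFun : ℝ → ℝ :=
  Set.indicator (Set.Icc (-1 / 2 : ℝ) (1 / 2)) (fun _ => 1)

/-- The centered B-spline `v_r` of order `r`: the convolution of `v_1 = boxFun` with itself `r - 1`
times (the value at `r = 0` is not used). -/
def bspline : ℕ → ℝ → ℝ
  | 0 => 0
  | 1 => boxFun
  | n + 2 => convolution (bspline (n + 1)) boxFun (ContinuousLinearMap.mul ℝ ℝ) volume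

/-- The scaled and shifted B-spline `φ_l(x) = v_r(h⁻¹ x - l - (r - 2) / 2)`, where `h = 1 / N`. -/
def splinePhi (r N : ℕ) (l : ℤ) (x : ℝ) : ℝ :=
  bspline r ((1 / (N : ℝ))⁻¹ * x - (l : ℝ) - ((r : ℝ) - 2) / 2)

/-- The periodic basis function `Φ_j(x) = ∑_{l ∈ ℤ} φ_{j + l N}(x)`; for `N ≥ 1` and each `x` only
finitely many terms are nonzero. -/
def periodicSpline (r N : ℕ) (j : ℤ) (x : ℝ) : ℝ :=
  ∑' l : ℤ, splinePhi r N (j + l * (N : ℤ)) x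

/-- The Gram matrix `G_{ij} = h⁻¹ (Φ_j, Φ_i)`, `1 ≤ i, j ≤ N`, with the inner product of `L²(0, 1)`.
The element `i` of `Fin N` stands for the index `i + 1`. -/
def splineGram (r N : ℕ) : Matrix (Fin N) (Fin N) ℝ :=
  Matrix.of fun i j => (1 / (N : ℝ))⁻¹ *
    ∫ x in (0 : ℝ)..1, periodicSpline r N ((j : ℤ) + 1) x * periodicSpline r N ((i : ℤ) + 1) x

/-- The entry `γ_i`, `1 ≤ i ≤ N`, of the first row of `Γ = G⁻¹` (and `0` for other `i`). -/
def splineGamma (r N i : ℕ) : ℝ :=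
  if hi : 1 ≤ i ∧ i ≤ N then
    (splineGram r N)⁻¹ ⟨0, by omega⟩ ⟨i - 1, by omega⟩
  else 0

end

/-! The matrix `G` is symmetric and cyclically banded, with `G_{ij} = 0` at cyclic distance at least
`r`, and its quadratic form lies between `m |x|²` and `M |x|²` with `0 < m < M` independent of `N`.
These facts alone force decay of the inverse. For `B = 1 - M⁻¹ G` one has `0 ≤ B ≤ ρ = 1 - m / M <
1` and `G⁻¹ = M⁻¹ ∑_{k<K} B^k + G⁻¹ B^K`. Since `B^k` has cyclic bandwidth `k (r - 1)`, the sum does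
not reach an entry at cyclic distance `D` when `K = ⌊D / (r - 1)⌋`, and the remainder is at most
`ρ^K / m` (`Matrix.abs_inv_apply_le`).

The uniform bounds come from cutting `[0, 1]` into mesh intervals. On each, the energy of a spline
is one fixed form on `ℝ^r`, positive definite because the `r` B-spline pieces are linearly
independent (`eq_zero_of_sum_bsplinePiece_eq_zero`). Each coefficient enters exactly `r` local forms
(`sum_meshIncidence_mulVec_sq`). -/

noncomputable section

/-- The `k`-th polynomial piece of the B-spline of order `r`, transported to the unit interval. -/
def bsplinePiece (r : ℕ) (k : ℤ) (t : ℝ) : ℝ :=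
  bspline r (t + k - (r : ℝ) / 2)

/-! ### B-splines and their pieces: support, recursion, derivative -/

theorem integrable_boxFun : Integrable boxFun volume := by
  unfold boxFun
  rw [integrable_indicator_iff measurableSet_Icc]
  exact integrableOn_const (by simp)

theorem integrable_bspline (n : ℕ) : Integrable (bspline (n + 1)) volume := by
  induction n with
  | zero => exact integrable_boxFun
  | succ n ih => exact ih.integrable_convolution (ContinuousLinearMap.mul ℝ ℝ) integrable_boxFun

theorem bspline_eq_integral (n : ℕ) (x : ℝ) :
    bspline (n + 2) x = ∫ t in (x - 1 / 2)..(x + 1 / 2), bspline (n + 1) t := by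
  rw [intervalIntegral.integral_of_le (by linarith), ← integral_Icc_eq_integral_Ioc,
    ← integral_indicator measurableSet_Icc]
  simp only [bspline, convolution, ContinuousLinearMap.mul_apply']
  congr 1
  ext t
  by_cases ht : t ∈ Set.Icc (x - 1 / 2) (x + 1 / 2)
  · rw [Set.indicator_of_mem ht, boxFun, Set.indicator_of_mem, mul_one]
    constructor <;> linarith [ht.1, ht.2]
  · rw [Set.indicator_of_notMem ht, boxFun, Set.indicator_of_notMem, mul_zero]
    intro h
    exact ht ⟨by linarith [h.2], by linarith [h.1]⟩

theorem intervalIntegrable_bspline (n : ℕ) (a b : ℝ) :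
    IntervalIntegrable (bspline (n + 1)) volume a b :=
  (integrable_bspline n).intervalIntegrable

theorem continuous_bspline (n : ℕ) : Continuous (bspline (n + 2)) := by
  have h : bspline (n + 2) = fun x => (∫ t in (0 : ℝ)..(x + 1 / 2), bspline (n + 1) t) -
      ∫ t in (0 : ℝ)..(x - 1 / 2), bspline (n + 1) t := by
    ext x
    rw [bspline_eq_integral, intervalIntegral.integral_interval_sub_left] <;>
      exact intervalIntegrable_bspline _ _ _
  have hc := intervalIntegral.continuous_primitive
    (fun a b => intervalIntegrable_bspline n a b) 0
  rw [h]
  exact (hc.comp (by fun_prop)).sub (hc.comp (by fun_prop))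

theorem bspline_eq_zero (n : ℕ) (x : ℝ) (hx : ((n : ℝ) + 1) / 2 < |x|) :
    bspline (n + 1) x = 0 := by
  induction n generalizing x with
  | zero =>
    simp only [bspline, boxFun]
    apply Set.indicator_of_notMem
    intro h
    have : |x| ≤ 1 / 2 := abs_le.2 ⟨by linarith [h.1], h.2⟩
    norm_num at hx
    linarith
  | succ n ih =>
    rw [bspline_eq_integral, intervalIntegral.integral_congr (g := fun _ => 0)]
    · simp
    · intro t ht
      rw [Set.uIcc_of_le (by linarith)] at ht
      apply ih
      push_cast at hx
      have h1 : |x - t| ≤ 1 / 2 := abs_le.2 ⟨by linarith [ht.2], by linarith [ht.1]⟩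
      have h2 : |x| ≤ |x - t| + |t| := by simpa using abs_add_le (x - t) t
      linarith

theorem bsplinePiece_eq_zero (n : ℕ) (k : ℤ) (hk : k < 0 ∨ (n : ℤ) + 1 ≤ k) (t : ℝ)
    (ht : t ∈ Set.Ioo (0 : ℝ) 1) : bsplinePiece (n + 1) k t = 0 := by
  apply bspline_eq_zero
  push_cast
  rcases hk with hk | hk
  · have : (k : ℝ) ≤ -1 := by exact_mod_cast (by omega : k ≤ -1)
    rw [abs_of_neg] <;> linarith [ht.1, ht.2, (Nat.cast_nonneg n : (0 : ℝ) ≤ n)]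
  · have : (n : ℝ) + 1 ≤ k := by exact_mod_cast hk
    exact lt_of_lt_of_le (by linarith [ht.1]) (le_abs_self _)

theorem bsplinePiece_one (k : ℤ) (t : ℝ) (ht : t ∈ Set.Ioo (0 : ℝ) 1) :
    bsplinePiece 1 k t = if k = 0 then 1 else 0 := by
  split_ifs with h
  · subst h
    simp only [bsplinePiece, bspline, boxFun]
    apply Set.indicator_of_mem
    push_cast
    constructor <;> linarith [ht.1, ht.2]
  · exact bsplinePiece_eq_zero 0 k (by push_cast; omega) t ht

theorem intervalIntegrable_bsplinePiece (n : ℕ) (k : ℤ) (a b : ℝ) :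
    IntervalIntegrable (bsplinePiece (n + 1) k) volume a b := by
  have h := (integrable_bspline n).comp_add_right ((k : ℝ) - ((n + 1 : ℕ) : ℝ) / 2)
  refine Integrable.intervalIntegrable (h.congr (Filter.Eventually.of_forall fun t => ?_))
  simp only [bsplinePiece]
  ring_nf

theorem continuous_bsplinePiece (n : ℕ) (k : ℤ) : Continuous (bsplinePiece (n + 2) k) :=
  (continuous_bspline n).comp (by fun_prop)

theorem continuousAt_bsplinePiece (n : ℕ) (k : ℤ) (t : ℝ) (ht : t ∈ Set.Ioo (0 : ℝ) 1) :
    ContinuousAt (bsplinePiece (n + 1) k) t := by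
  cases n with
  | zero =>
    refine (continuousAt_const (y := if k = 0 then (1 : ℝ) else 0)).congr ?_
    filter_upwards [Ioo_mem_nhds ht.1 ht.2] with s hs
    exact (bsplinePiece_one k s hs).symm
  | succ n => exact (continuous_bsplinePiece n k).continuousAt

/-- The unit averaging window contains one knot of the lower-order spline; the integral is split
there. -/
theorem bsplinePiece_succ (n : ℕ) (k : ℤ) (t : ℝ) :
    bsplinePiece (n + 2) k t = (∫ s in t..1, bsplinePiece (n + 1) (k - 1) s) +
      ∫ s in (0 : ℝ)..t, bsplinePiece (n + 1) k s := by
  have h1 : (∫ s in t..1, bsplinePiece (n + 1) (k - 1) s) =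
      ∫ s in (t + ((k : ℝ) - 1 - ((n : ℝ) + 1) / 2))..(1 + ((k : ℝ) - 1 - ((n : ℝ) + 1) / 2)),
        bspline (n + 1) s := by
    rw [← intervalIntegral.integral_comp_add_right]
    simp only [bsplinePiece]
    push_cast
    simp only [add_sub_assoc]
  have h2 : (∫ s in (0 : ℝ)..t, bsplinePiece (n + 1) k s) =
      ∫ s in (0 + ((k : ℝ) - ((n : ℝ) + 1) / 2))..(t + ((k : ℝ) - ((n : ℝ) + 1) / 2)),
        bspline (n + 1) s := by
    rw [← intervalIntegral.integral_comp_add_right]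
    simp only [bsplinePiece]
    push_cast
    simp only [add_sub_assoc]
  rw [h1, h2, show 1 + ((k : ℝ) - 1 - ((n : ℝ) + 1) / 2) = 0 + ((k : ℝ) - ((n : ℝ) + 1) / 2) by ring,
    intervalIntegral.integral_add_adjacent_intervals (intervalIntegrable_bspline _ _ _)
      (intervalIntegrable_bspline _ _ _), bsplinePiece, bspline_eq_integral]
  push_cast
  congr 1 <;> ring

theorem hasDerivAt_bsplinePiece (n : ℕ) (k : ℤ) (t : ℝ) (ht : t ∈ Set.Ioo (0 : ℝ) 1) :
    HasDerivAt (bsplinePiece (n + 2) k)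
      (bsplinePiece (n + 1) k t - bsplinePiece (n + 1) (k - 1) t) t := by
  have hm : ∀ j : ℤ, StronglyMeasurableAtFilter (bsplinePiece (n + 1) j) (nhds t) volume := by
    intro j
    have : ∀ s ∈ Set.Ioo (0 : ℝ) 1, ContinuousAt (bsplinePiece (n + 1) j) s :=
      continuousAt_bsplinePiece n j
    exact ContinuousAt.stronglyMeasurableAtFilter isOpen_Ioo this t ht
  have h1 := intervalIntegral.integral_hasDerivAt_left
    (intervalIntegrable_bsplinePiece n (k - 1) t 1) (hm _) (continuousAt_bsplinePiece n _ t ht)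
  have h2 := intervalIntegral.integral_hasDerivAt_right
    (intervalIntegrable_bsplinePiece n k 0 t) (hm _) (continuousAt_bsplinePiece n _ t ht)
  rw [show bsplinePiece (n + 2) k = _ from funext (bsplinePiece_succ n k)]
  exact (h1.fun_add h2).congr_deriv (by ring)

theorem integral_bsplinePiece_eq_zero (n : ℕ) (k : ℤ) (hk : k < 0 ∨ (n : ℤ) + 1 ≤ k) (a b : ℝ)
    (ha : 0 ≤ a) (hab : a ≤ b) (hb : b ≤ 1) : ∫ s in a..b, bsplinePiece (n + 1) k s = 0 := by
  rw [intervalIntegral.integral_of_le hab, integral_Ioc_eq_integral_Ioo]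
  exact setIntegral_eq_zero_of_forall_eq_zero fun s hs =>
    bsplinePiece_eq_zero n k hk s ⟨ha.trans_lt hs.1, hs.2.trans_le hb⟩

/-! ### Partition of unity and local linear independence -/

theorem sum_bsplinePiece (n : ℕ) (t : ℝ) (ht : t ∈ Set.Ioo (0 : ℝ) 1) :
    ∑ k ∈ Finset.range (n + 1), bsplinePiece (n + 1) (k : ℤ) t = 1 := by
  induction n generalizing t with
  | zero => simp [bsplinePiece_one 0 t ht]
  | succ n ih =>
    simp only [bsplinePiece_succ, Finset.sum_add_distrib]
    rw [Finset.sum_range_succ', Finset.sum_range_succ (n := n + 1),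
      integral_bsplinePiece_eq_zero n _ (by simp) t 1 ht.1.le ht.2.le le_rfl,
      integral_bsplinePiece_eq_zero n ((n + 1 : ℕ) : ℤ) (by simp) 0 t le_rfl ht.1.le ht.2.le]
    have hs : ∀ k : ℕ, ((k + 1 : ℕ) : ℤ) - 1 = k := by intro k; simp
    simp only [hs, add_zero]
    rw [← intervalIntegral.integral_finsetSum fun (k : ℕ) _ => intervalIntegrable_bsplinePiece n k t 1,
      ← intervalIntegral.integral_finsetSum fun (k : ℕ) _ => intervalIntegrable_bsplinePiece n k 0 t,
      add_comm, intervalIntegral.integral_add_adjacent_intervals,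
      intervalIntegral.integral_of_le zero_le_one, integral_Ioc_eq_integral_Ioo,
      setIntegral_congr_fun measurableSet_Ioo (g := fun _ => (1 : ℝ)) fun s hs => ih s hs]
    · simp
    all_goals
      simpa only [Finset.sum_fn] using IntervalIntegrable.sum (Finset.range (n + 1))
        (f := fun k => bsplinePiece (n + 1) (k : ℤ))
        fun k _ => intervalIntegrable_bsplinePiece n k _ _

/-- Differentiating a relation lowers the order and replaces the coefficients by `c k - c (k + 1)`.
By induction all coefficients agree, and the partition of unity shows that their common value is
zero. -/
theorem eq_zero_of_sum_bsplinePiece_eq_zero (n : ℕ) (c : ℕ → ℝ)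
    (hc : ∀ t ∈ Set.Ioo (0 : ℝ) 1,
      ∑ k ∈ Finset.range (n + 1), c k * bsplinePiece (n + 1) (k : ℤ) t = 0) :
    ∀ k ≤ n, c k = 0 := by
  induction n generalizing c with
  | zero =>
    have h := hc (1 / 2) (by norm_num)
    rw [Finset.sum_range_one, Nat.cast_zero, bsplinePiece_one 0 _ (by norm_num)] at h
    intro k hk
    obtain rfl : k = 0 := by omega
    simpa using h
  | succ n ih =>
    have hd : ∀ t ∈ Set.Ioo (0 : ℝ) 1,
        ∑ k ∈ Finset.range (n + 1), (c k - c (k + 1)) * bsplinePiece (n + 1) (k : ℤ) t = 0 := by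
      intro t ht
      have h1 : HasDerivAt (fun s => ∑ k ∈ Finset.range (n + 2),
          c k * bsplinePiece (n + 2) (k : ℤ) s)
          (∑ k ∈ Finset.range (n + 2), c k *
            (bsplinePiece (n + 1) k t - bsplinePiece (n + 1) (k - 1) t)) t :=
        HasDerivAt.fun_sum fun k _ => (hasDerivAt_bsplinePiece n k t ht).const_mul (c k)
      have h2 : HasDerivAt (fun s => ∑ k ∈ Finset.range (n + 2),
          c k * bsplinePiece (n + 2) (k : ℤ) s) 0 t := by
        refine (hasDerivAt_const t (0 : ℝ)).congr_of_eventuallyEq ?_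
        filter_upwards [Ioo_mem_nhds ht.1 ht.2] with s hs
        exact hc s hs
      have h3 := h1.unique h2
      simp only [mul_sub, Finset.sum_sub_distrib] at h3
      rw [Finset.sum_range_succ, Finset.sum_range_succ' (n := n + 1),
        bsplinePiece_eq_zero n _ (by simp) t ht, bsplinePiece_eq_zero n _ (by simp) t ht] at h3
      have hs : ∀ k : ℕ, ((k + 1 : ℕ) : ℤ) - 1 = k := by intro k; simp
      simp only [hs, mul_zero, add_zero] at h3
      simpa only [sub_mul, Finset.sum_sub_distrib] using h3
    have hs := ih _ hd
    have hall : ∀ k ≤ n + 1, c k = c 0 := by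
      intro k
      induction k with
      | zero => simp
      | succ k ihk =>
        intro hk
        rw [← ihk (by omega)]
        linarith [hs k (by omega)]
    have h0 := hc (1 / 2) (by norm_num)
    rw [Finset.sum_congr rfl (g := fun k : ℕ => c 0 * bsplinePiece (n + 1 + 1) (k : ℤ) (1 / 2))
      fun k hk => by rw [hall k (by have := Finset.mem_range.1 hk; omega)],
      ← Finset.mul_sum, sum_bsplinePiece (n + 1) _ (by norm_num), mul_one] at h0
    intro k hk
    rw [hall k hk, h0]

/-! ### The quadratic form of one mesh interval -/

/-- The local Gram form of the pieces of the B-spline of order `r` on a mesh interval. -/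
def localForm (r : ℕ) (c : Fin r → ℝ) : ℝ :=
  ∫ t in (0 : ℝ)..1, (∑ k : Fin r, c k * bsplinePiece r ((k : ℕ) : ℤ) t) ^ 2

theorem localForm_pos (n : ℕ) (c : Fin (n + 2) → ℝ) (hc : c ≠ 0) : 0 < localForm (n + 2) c := by
  have hcont : Continuous fun t => ∑ k : Fin (n + 2), c k * bsplinePiece (n + 2) ((k : ℕ) : ℤ) t :=
    continuous_finsetSum _ fun k _ => continuous_const.mul (continuous_bsplinePiece n _)
  obtain ⟨t, ht, hne⟩ : ∃ t ∈ Set.Ioo (0 : ℝ) 1,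
      ∑ k : Fin (n + 2), c k * bsplinePiece (n + 2) ((k : ℕ) : ℤ) t ≠ 0 := by
    by_contra! hcon
    apply hc
    ext k
    have := eq_zero_of_sum_bsplinePiece_eq_zero (n + 1)
      (fun k => if hk : k < n + 2 then c ⟨k, hk⟩ else 0) (fun t ht => by
        rw [Finset.sum_range, ← hcon t ht]
        exact Finset.sum_congr rfl fun k _ => by simp) k (by omega)
    simpa using this
  exact intervalIntegral.integral_pos zero_lt_one (hcont.pow 2).continuousOn
    (fun s _ => sq_nonneg _) ⟨t, Set.Ioo_subset_Icc_self ht, by positivity⟩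

/-- The Gram matrix over a mesh interval of the pieces of the B-spline of order `r`. -/
def localGram (r : ℕ) : Matrix (Fin r) (Fin r) ℝ :=
  Matrix.of fun k l => ∫ t in (0 : ℝ)..1,
    bsplinePiece r ((k : ℕ) : ℤ) t * bsplinePiece r ((l : ℕ) : ℤ) t

theorem integral_sum_bsplinePiece_mul (n : ℕ) (c d : Fin (n + 2) → ℝ) :
    (∫ t in (0 : ℝ)..1, (∑ k, c k * bsplinePiece (n + 2) ((k : ℕ) : ℤ) t) *
      ∑ l, d l * bsplinePiece (n + 2) ((l : ℕ) : ℤ) t) =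
    c ⬝ᵥ (localGram (n + 2)).mulVec d := by
  simp only [Finset.sum_mul_sum]
  simp only [dotProduct, Matrix.mulVec, localGram, Matrix.of_apply, Finset.mul_sum]
  have hi : ∀ k l : Fin (n + 2), IntervalIntegrable (fun t =>
      c k * bsplinePiece (n + 2) ((k : ℕ) : ℤ) t * (d l * bsplinePiece (n + 2) ((l : ℕ) : ℤ) t))
      volume 0 1 := fun k l => Continuous.intervalIntegrable
    ((continuous_const.mul (continuous_bsplinePiece n _)).mul
      (continuous_const.mul (continuous_bsplinePiece n _))) _ _
  rw [intervalIntegral.integral_finsetSum]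
  · refine Finset.sum_congr rfl fun k _ => ?_
    rw [intervalIntegral.integral_finsetSum fun l _ => hi k l]
    refine Finset.sum_congr rfl fun l _ => ?_
    rw [← intervalIntegral.integral_mul_const, ← intervalIntegral.integral_const_mul]
    congr 1
    ext t
    ring
  · intro k _
    simpa only [Finset.sum_fn] using IntervalIntegrable.sum Finset.univ fun l _ => hi k l

theorem localForm_eq (n : ℕ) (c : Fin (n + 2) → ℝ) :
    localForm (n + 2) c = c ⬝ᵥ (localGram (n + 2)).mulVec c := by
  simp only [localForm, sq, integral_sum_bsplinePiece_mul]

theorem continuous_localForm (n : ℕ) : Continuous (localForm (n + 2)) := by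
  rw [show localForm (n + 2) = _ from funext (localForm_eq n)]
  simp only [dotProduct, Matrix.mulVec]
  fun_prop

theorem localForm_smul (r : ℕ) (a : ℝ) (c : Fin r → ℝ) :
    localForm r (a • c) = a ^ 2 * localForm r c := by
  simp only [localForm, Pi.smul_apply, smul_eq_mul, mul_assoc, ← Finset.mul_sum, mul_pow,
    intervalIntegral.integral_const_mul]

theorem exists_localForm_bounds (n : ℕ) : ∃ m M : ℝ, 0 < m ∧ m < M ∧ ∀ c : Fin (n + 2) → ℝ,
    m * ∑ k, c k ^ 2 ≤ localForm (n + 2) c ∧ localForm (n + 2) c ≤ M * ∑ k, c k ^ 2 := by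
  have hS : IsCompact {c : Fin (n + 2) → ℝ | ∑ k, c k ^ 2 = 1} := by
    refine Metric.isCompact_of_isClosed_isBounded (isClosed_eq (by fun_prop) continuous_const)
      ((Metric.isBounded_closedBall (x := 0) (r := 1)).subset fun c hc => ?_)
    rw [mem_closedBall_zero_iff, pi_norm_le_iff_of_nonneg zero_le_one]
    intro k
    rw [Real.norm_eq_abs, ← sq_le_one_iff_abs_le_one, ← (show ∑ k, c k ^ 2 = 1 from hc)]
    exact Finset.single_le_sum (f := fun k => c k ^ 2) (fun i _ => sq_nonneg _) (Finset.mem_univ k)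
  have hne : {c : Fin (n + 2) → ℝ | ∑ k, c k ^ 2 = 1}.Nonempty := by
    refine ⟨Pi.single 0 1, ?_⟩
    simp [Pi.single_apply]
  obtain ⟨a, ha, hamin⟩ := hS.exists_isMinOn hne (continuous_localForm n).continuousOn
  obtain ⟨b, hb, hbmax⟩ := hS.exists_isMaxOn hne (continuous_localForm n).continuousOn
  have ha0 : a ≠ 0 := by
    rintro rfl
    simp at ha
  have hab : localForm (n + 2) a ≤ localForm (n + 2) b := hamin hb
  -- Extrema over the unit sphere; the `+ 1` makes `m < M` strict, so that later `1 - m / M` is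
  -- positive.
  refine ⟨localForm (n + 2) a, localForm (n + 2) b + 1, localForm_pos n a ha0, by linarith, ?_⟩
  intro c
  by_cases hc : c = 0
  · subst hc
    simp [localForm]
  have hpos : 0 < ∑ k, c k ^ 2 := by
    obtain ⟨k, hk⟩ := Function.ne_iff.1 hc
    exact Finset.sum_pos' (fun i _ => sq_nonneg _) ⟨k, Finset.mem_univ k, sq_pos_of_ne_zero hk⟩
  set S := ∑ k, c k ^ 2 with hSdef
  have hmem : (Real.sqrt S)⁻¹ • c ∈ {c : Fin (n + 2) → ℝ | ∑ k, c k ^ 2 = 1} := by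
    simp only [Set.mem_ofPred_eq, Pi.smul_apply, smul_eq_mul, mul_pow, ← Finset.mul_sum, inv_pow,
      Real.sq_sqrt hpos.le, ← hSdef]
    exact inv_mul_cancel₀ hpos.ne'
  have h1 : localForm (n + 2) a ≤ _ := hamin hmem
  have h2 : _ ≤ localForm (n + 2) b := hbmax hmem
  rw [localForm_smul, inv_pow, Real.sq_sqrt hpos.le, inv_mul_eq_div] at h1 h2
  rw [le_div_iff₀ hpos] at h1
  rw [div_le_iff₀ hpos] at h2
  exact ⟨h1, by linarith⟩

end

/-! ### Inverses of coercive symmetric matrices -/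

section

open Matrix

variable {ι : Type*} [Fintype ι]

theorem Matrix.real_dotProduct_self_nonneg (x : ι → ℝ) : 0 ≤ x ⬝ᵥ x :=
  Finset.sum_nonneg fun _ _ => mul_self_nonneg _

theorem Matrix.dotProduct_mulVec_sq_le {B : Matrix ι ι ℝ} (hB : B.IsSymm)
    (h0 : ∀ x : ι → ℝ, 0 ≤ x ⬝ᵥ B *ᵥ x) (x y : ι → ℝ) :
    (x ⬝ᵥ B *ᵥ y) ^ 2 ≤ (x ⬝ᵥ B *ᵥ x) * (y ⬝ᵥ B *ᵥ y) := by
  have hsymm : y ⬝ᵥ B *ᵥ x = x ⬝ᵥ B *ᵥ y := by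
    rw [dotProduct_mulVec, ← mulVec_transpose, hB.eq, dotProduct_comm]
  have h : ∀ a : ℝ, 0 ≤ (y ⬝ᵥ B *ᵥ y) * (a * a) + (2 * (x ⬝ᵥ B *ᵥ y)) * a + x ⬝ᵥ B *ᵥ x := by
    intro a
    have := h0 (x + a • y)
    simp only [mulVec_add, mulVec_smul, dotProduct_add, add_dotProduct, dotProduct_smul,
      smul_dotProduct, smul_eq_mul, hsymm] at this
    linarith
  have := discrim_le_zero h
  rw [discrim] at this
  linarith

/-- Cauchy–Schwarz for the form of `B`, applied to `B x` and `x`, gives `|Bx|⁴ ≤ ρ |Bx|² · ρ |x|²`;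
no spectral theorem is needed. -/
theorem Matrix.mulVec_dotProduct_self_le {B : Matrix ι ι ℝ} (hB : B.IsSymm) {ρ : ℝ} (hρ : 0 ≤ ρ)
    (h0 : ∀ x : ι → ℝ, 0 ≤ x ⬝ᵥ B *ᵥ x) (h1 : ∀ x : ι → ℝ, x ⬝ᵥ B *ᵥ x ≤ ρ * (x ⬝ᵥ x))
    (x : ι → ℝ) : (B *ᵥ x) ⬝ᵥ (B *ᵥ x) ≤ ρ ^ 2 * (x ⬝ᵥ x) := by
  have hcs := Matrix.dotProduct_mulVec_sq_le hB h0 (B *ᵥ x) x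
  have hx : 0 ≤ x ⬝ᵥ x := real_dotProduct_self_nonneg x
  have hy : 0 ≤ (B *ᵥ x) ⬝ᵥ (B *ᵥ x) := real_dotProduct_self_nonneg _
  rcases hy.eq_or_lt with hy0 | hy0
  · rw [← hy0]
    positivity
  have h2 : (B *ᵥ x ⬝ᵥ B *ᵥ x) ^ 2 ≤ (ρ * (B *ᵥ x ⬝ᵥ B *ᵥ x)) * (ρ * (x ⬝ᵥ x)) :=
    hcs.trans (mul_le_mul (h1 _) (h1 _) (h0 _) (by positivity))
  nlinarith

theorem Matrix.pow_mulVec_dotProduct_self_le [DecidableEq ι] {B : Matrix ι ι ℝ} {ρ : ℝ}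
    (h : ∀ x : ι → ℝ, (B *ᵥ x) ⬝ᵥ (B *ᵥ x) ≤ ρ ^ 2 * (x ⬝ᵥ x)) (K : ℕ) (x : ι → ℝ) :
    (B ^ K *ᵥ x) ⬝ᵥ (B ^ K *ᵥ x) ≤ (ρ ^ K) ^ 2 * (x ⬝ᵥ x) := by
  induction K with
  | zero => simp
  | succ K ih =>
    rw [pow_succ', ← mulVec_mulVec]
    refine (h _).trans ?_
    rw [pow_succ' ρ K, mul_pow ρ, mul_assoc]
    exact mul_le_mul_of_nonneg_left ih (sq_nonneg _)

theorem Matrix.isUnit_det_of_coercive [DecidableEq ι] {G : Matrix ι ι ℝ} {m : ℝ} (hm : 0 < m)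
    (h : ∀ x : ι → ℝ, m * (x ⬝ᵥ x) ≤ x ⬝ᵥ G *ᵥ x) : IsUnit G.det := by
  rw [isUnit_iff_ne_zero]
  intro h0
  obtain ⟨x, hx, hGx⟩ := exists_mulVec_eq_zero_iff.2 h0
  have := h x
  rw [hGx, dotProduct_zero] at this
  have hpos : 0 < x ⬝ᵥ x := (real_dotProduct_self_nonneg x).lt_of_ne'
    (fun h => hx (dotProduct_self_eq_zero.1 h))
  nlinarith [mul_pos hm hpos]

/-- With `z = G⁻¹ y`, coercivity reads `m |z|² ≤ z · y`; combine it with `0 ≤ |y - m z|²`. -/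
theorem Matrix.sq_mul_inv_mulVec_le [DecidableEq ι] {G : Matrix ι ι ℝ} {m : ℝ} (hm : 0 < m)
    (h : ∀ x : ι → ℝ, m * (x ⬝ᵥ x) ≤ x ⬝ᵥ G *ᵥ x) (y : ι → ℝ) :
    m ^ 2 * ((G⁻¹ *ᵥ y) ⬝ᵥ (G⁻¹ *ᵥ y)) ≤ y ⬝ᵥ y := by
  have hu := Matrix.isUnit_det_of_coercive hm h
  have h1 := h (G⁻¹ *ᵥ y)
  rw [mulVec_mulVec, mul_nonsing_inv _ hu, one_mulVec] at h1
  have h2 : 0 ≤ (y - m • (G⁻¹ *ᵥ y)) ⬝ᵥ (y - m • (G⁻¹ *ᵥ y)) := real_dotProduct_self_nonneg _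
  simp only [dotProduct_sub, sub_dotProduct, dotProduct_smul, smul_dotProduct, smul_eq_mul,
    dotProduct_comm y (G⁻¹ *ᵥ y)] at h2
  nlinarith

/-- Entries of the inverse of a matrix `G` with `m ≤ G ≤ M` that are not reached by the powers
`B ^ k`, `k < K`, of `B = 1 - M⁻¹ G` are of size at most `(1 - m / M) ^ K / m`. -/
theorem Matrix.abs_inv_apply_le [DecidableEq ι] {G : Matrix ι ι ℝ} {m M : ℝ} (hm : 0 < m)
    (hmM : m < M) (hG : G.IsSymm) (h0 : ∀ x : ι → ℝ, m * (x ⬝ᵥ x) ≤ x ⬝ᵥ G *ᵥ x)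
    (h1 : ∀ x : ι → ℝ, x ⬝ᵥ G *ᵥ x ≤ M * (x ⬝ᵥ x)) (i j : ι) (K : ℕ)
    (hK : ∀ k < K, ((1 - M⁻¹ • G) ^ k) i j = 0) :
    |G⁻¹ i j| ≤ m⁻¹ * (1 - m / M) ^ K := by
  have hM : 0 < M := hm.trans hmM
  set B : Matrix ι ι ℝ := 1 - M⁻¹ • G with hBdef
  set ρ : ℝ := 1 - m / M with hρdef
  have hρ : 0 ≤ ρ := by
    rw [hρdef, sub_nonneg, div_le_one hM]
    exact hmM.le
  have hu := Matrix.isUnit_det_of_coercive hm h0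
  have hB : B.IsSymm := isSymm_one.sub (hG.smul _)
  have hform : ∀ x : ι → ℝ, x ⬝ᵥ B *ᵥ x = x ⬝ᵥ x - M⁻¹ * (x ⬝ᵥ G *ᵥ x) := by
    intro x
    simp only [hBdef, sub_mulVec, one_mulVec, smul_mulVec, dotProduct_sub, dotProduct_smul,
      smul_eq_mul]
  have hB0 : ∀ x : ι → ℝ, 0 ≤ x ⬝ᵥ B *ᵥ x := by
    intro x
    rw [hform, sub_nonneg, inv_mul_le_iff₀ hM]
    exact h1 x
  have hB1 : ∀ x : ι → ℝ, x ⬝ᵥ B *ᵥ x ≤ ρ * (x ⬝ᵥ x) := by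
    intro x
    have := mul_le_mul_of_nonneg_left (h0 x) (inv_pos.2 hM).le
    rw [hform, hρdef, div_eq_inv_mul]
    linarith
  have hpow := Matrix.pow_mulVec_dotProduct_self_le
    (Matrix.mulVec_dotProduct_self_le hB hρ hB0 hB1) K (Pi.single j 1)
  -- Neumann series truncated with an exact remainder, the only term that contributes at `(i, j)`.
  have hgeom : G⁻¹ = M⁻¹ • ∑ k ∈ Finset.range K, B ^ k + G⁻¹ * B ^ K := by
    have hg := mul_neg_geom_sum B K
    have h1B : 1 - B = M⁻¹ • G := by simp [hBdef]
    rw [h1B] at hg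
    have := congrArg (G⁻¹ * ·) hg
    simp only [smul_mul_assoc, mul_smul_comm, mul_sub, mul_one] at this
    rw [← Matrix.mul_assoc, nonsing_inv_mul _ hu, Matrix.one_mul] at this
    rw [this, sub_add_cancel]
  have hentry : G⁻¹ i j = (G⁻¹ *ᵥ (B ^ K *ᵥ Pi.single j 1)) i := by
    rw [mulVec_mulVec, mulVec_single_one, col_apply]
    conv_lhs => rw [hgeom]
    rw [add_apply, smul_apply, sum_apply,
      Finset.sum_eq_zero fun k hk => hK k (Finset.mem_range.1 hk), smul_zero, zero_add]
  have hinv := Matrix.sq_mul_inv_mulVec_le hm h0 (B ^ K *ᵥ Pi.single j 1)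
  set z := G⁻¹ *ᵥ (B ^ K *ᵥ Pi.single j 1) with hz
  have hzi : z i ^ 2 ≤ z ⬝ᵥ z := by
    rw [sq]
    exact Finset.single_le_sum (f := fun i => z i * z i) (fun i _ => mul_self_nonneg _)
      (Finset.mem_univ i)
  rw [dotProduct_single_one, Pi.single_eq_same, mul_one] at hpow
  have hsq : (m * z i) ^ 2 ≤ (ρ ^ K) ^ 2 := by
    rw [mul_pow]
    exact (mul_le_mul_of_nonneg_left hzi (sq_nonneg m)).trans (hinv.trans hpow)
  have := abs_le_of_sq_le_sq hsq (by positivity)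
  rw [hentry, ← div_eq_inv_mul, le_div_iff₀ hm, mul_comm]
  rw [← abs_of_pos hm, ← abs_mul]
  exact this

end

/-! ### Decay for cyclically banded matrices -/

theorem Matrix.cyclicBand_pow {N s : ℕ} {B : Matrix (Fin N) (Fin N) ℝ}
    (hB : ∀ i j, B i j ≠ 0 → ∃ d : ℤ, |d| ≤ s ∧ (N : ℤ) ∣ (i : ℤ) - j - d) (k : ℕ)
    (i j : Fin N) (h : (B ^ k) i j ≠ 0) :
    ∃ d : ℤ, |d| ≤ k * s ∧ (N : ℤ) ∣ (i : ℤ) - j - d := by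
  induction k generalizing j with
  | zero =>
    rw [pow_zero, Matrix.one_apply] at h
    obtain rfl : i = j := by
      by_contra hne
      simp [hne] at h
    exact ⟨0, by simp⟩
  | succ k ih =>
    rw [pow_succ, Matrix.mul_apply] at h
    obtain ⟨l, -, hl⟩ := Finset.exists_ne_zero_of_sum_ne_zero h
    obtain ⟨d, hd, hdvd⟩ := ih l (left_ne_zero_of_mul hl)
    obtain ⟨e, he, hevd⟩ := hB l j (right_ne_zero_of_mul hl)
    refine ⟨d + e, (abs_add_le d e).trans ?_, ?_⟩
    · push_cast
      linarith
    · have := dvd_add hdvd hevd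
      rwa [show (i : ℤ) - l - d + ((l : ℤ) - j - e) = i - j - (d + e) by ring] at this

/-- Exponential decay of the first row of the inverse of a cyclically banded symmetric matrix,
uniformly in its size. -/
theorem Matrix.exists_cyclicBand_inv_decay {s : ℕ} (hs : 0 < s) {m M : ℝ} (hm : 0 < m)
    (hmM : m < M) : ∃ C q : ℝ, 0 < C ∧ 1 < q ∧ ∀ (N : ℕ) (G : Matrix (Fin N) (Fin N) ℝ),
      G.IsSymm → (∀ x : Fin N → ℝ, m * (x ⬝ᵥ x) ≤ x ⬝ᵥ G.mulVec x) →
      (∀ x : Fin N → ℝ, x ⬝ᵥ G.mulVec x ≤ M * (x ⬝ᵥ x)) →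
      (∀ i j, G i j ≠ 0 → ∃ d : ℤ, |d| ≤ s ∧ (N : ℤ) ∣ (i : ℤ) - j - d) →
      ∀ i j : Fin N, (i : ℕ) = 0 →
        |G⁻¹ i j| ≤ C * q⁻¹ ^ (j : ℕ) + C * q⁻¹ ^ (N - j : ℕ) := by
  have hM : 0 < M := hm.trans hmM
  set ρ : ℝ := 1 - m / M with hρdef
  have hρ0 : 0 < ρ := by
    rw [hρdef, sub_pos, div_lt_one hM]
    exact hmM
  have hρ1 : ρ < 1 := by
    have := div_pos hm hM
    linarith
  -- One factor `ρ` is gained per `s` steps of distance, hence the `s`-th root. The factor `(p ^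
  -- s)⁻¹` in the constant pays for rounding `D / s` down.
  set p : ℝ := ρ ^ ((s : ℝ)⁻¹) with hp
  have hp0 : 0 < p := Real.rpow_pos_of_pos hρ0 _
  have hp1 : p < 1 := Real.rpow_lt_one hρ0.le hρ1 (by positivity)
  have hps : p ^ s = ρ := Real.rpow_inv_natCast_pow hρ0.le hs.ne'
  refine ⟨m⁻¹ * (p ^ s)⁻¹, p⁻¹, by positivity, (one_lt_inv₀ hp0).2 hp1, ?_⟩
  intro N G hG h0 h1 hband i j hi
  rw [inv_inv]
  set D := min (j : ℕ) (N - j) with hD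
  have hK : ∀ k < D / s, ((1 - M⁻¹ • G) ^ k) i j = 0 := by
    intro k hk
    by_contra hne
    have hBband : ∀ i j, (1 - M⁻¹ • G) i j ≠ 0 →
        ∃ d : ℤ, |d| ≤ s ∧ (N : ℤ) ∣ (i : ℤ) - j - d := by
      intro i j hij
      by_cases hij' : i = j
      · subst hij'
        exact ⟨0, by simp⟩
      · refine hband i j fun h => hij ?_
        simp [Matrix.one_apply_ne hij', h]
    obtain ⟨d, hd, l, hl⟩ := Matrix.cyclicBand_pow hBband k i j hne
    have hks : (k + 1) * s ≤ D := (Nat.mul_le_mul_right s hk).trans (Nat.div_mul_le_self D s)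
    have hlt : k * s < D := by nlinarith
    have hlt' : (k : ℤ) * s < D := by exact_mod_cast hlt
    have hDj : (D : ℤ) ≤ j := by exact_mod_cast min_le_left _ _
    have hDN : (D : ℤ) ≤ N - j := by
      have : D ≤ N - j := min_le_right _ _
      have := j.isLt
      omega
    rw [hi] at hl
    have habs := abs_le.1 hd
    have hN : (0 : ℤ) ≤ N := by positivity
    -- Here `-j - d = N l`: if `l ≥ 0` then `-d ≥ j`, otherwise `d ≥ N - j`. Both contradict `|d| ≤
    -- k s < D`.
    rcases le_or_gt 0 l with hl0 | hl0
    · have := mul_nonneg hN hl0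
      push_cast at hl
      linarith [habs.1]
    · have : (N : ℤ) * l ≤ N * (-1) := mul_le_mul_of_nonneg_left (by omega) hN
      push_cast at hl
      linarith [habs.2]
  have hmain := Matrix.abs_inv_apply_le hm hmM hG h0 h1 i j (D / s) hK
  have hpow : ρ ^ (D / s) ≤ (p ^ s)⁻¹ * p ^ D := by
    rw [le_inv_mul_iff₀ (by positivity), ← hps, ← pow_mul, ← pow_add]
    refine pow_le_pow_of_le_one hp0.le hp1.le ?_
    have h2 := Nat.div_add_mod D s
    have h3 := Nat.mod_lt D hs
    omega
  have hsum : p ^ D ≤ p ^ (j : ℕ) + p ^ (N - j : ℕ) := by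
    have ha : 0 < p ^ (j : ℕ) := by positivity
    have hb : 0 < p ^ (N - j : ℕ) := by positivity
    rcases min_choice (j : ℕ) (N - j) with h | h
    · rw [hD, h]
      linarith
    · rw [hD, h]
      linarith
  have hC : 0 < m⁻¹ * (p ^ s)⁻¹ := by positivity
  calc |G⁻¹ i j| ≤ m⁻¹ * ρ ^ (D / s) := hmain
    _ ≤ m⁻¹ * ((p ^ s)⁻¹ * p ^ D) := by gcongr
    _ = m⁻¹ * (p ^ s)⁻¹ * p ^ D := by ring
    _ ≤ m⁻¹ * (p ^ s)⁻¹ * (p ^ (j : ℕ) + p ^ (N - j : ℕ)) := by gcongr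
    _ = _ := by ring

/-! ### The weighted sum -/

theorem exists_sum_weighted_bound {C q : ℝ} (hC : 0 < C) (hq : 1 < q) : ∃ C₃ : ℝ, 0 < C₃ ∧
    ∀ (r N : ℕ) (g : ℕ → ℝ), 2 ≤ r → (∀ i : ℕ, r ≤ i → i ≤ N / 2 + 1 →
      |g i| ≤ C * q⁻¹ ^ (i - 1) + C * q⁻¹ ^ (N - i)) →
    ∑ i ∈ Finset.Icc r (N / 2 + 1), (1 + (i : ℝ)) * |g i| ≤ C₃ := by
  have hq0 : 0 < q := by linarith
  set p := q⁻¹ with hp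
  have hp0 : 0 < p := by positivity
  have hp1 : p < 1 := inv_lt_one_of_one_lt₀ hq
  have hn : ‖p‖ < 1 := by rwa [Real.norm_eq_abs, abs_of_pos hp0]
  have hsum : Summable fun i : ℕ => (1 + (i : ℝ)) * p ^ i := by
    have h1 := summable_pow_mul_geometric_of_norm_lt_one 1 hn
    have h0 := summable_geometric_of_lt_one hp0.le hp1
    refine (h0.add h1).congr fun i => ?_
    ring
  have hnn : ∀ i : ℕ, 0 ≤ (1 + (i : ℝ)) * p ^ i := fun i => by positivity
  refine ⟨2 * C * (p ^ 2)⁻¹ * (∑' i : ℕ, (1 + (i : ℝ)) * p ^ i) + 1,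
    add_pos_of_nonneg_of_pos (mul_nonneg (by positivity) (tsum_nonneg hnn)) one_pos, ?_⟩
  intro r N g hr hg
  have hterm : ∀ i ∈ Finset.Icc r (N / 2 + 1), (1 + (i : ℝ)) * |g i| ≤
      2 * C * (p ^ 2)⁻¹ * ((1 + (i : ℝ)) * p ^ i) := by
    intro i hi
    rw [Finset.mem_Icc] at hi
    have h1 : p ^ (i - 1) ≤ (p ^ 2)⁻¹ * p ^ i := by
      rw [le_inv_mul_iff₀ (by positivity), ← pow_add]
      exact pow_le_pow_of_le_one hp0.le hp1.le (by omega)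
    -- Up to the middle of the row `N - i ≥ i - 2`, so the wrapped-around exponential is also
    -- controlled by `p ^ i`.
    have h2 : p ^ (N - i) ≤ (p ^ 2)⁻¹ * p ^ i := by
      rw [le_inv_mul_iff₀ (by positivity), ← pow_add]
      exact pow_le_pow_of_le_one hp0.le hp1.le (by omega)
    have h3 : |g i| ≤ 2 * C * (p ^ 2)⁻¹ * p ^ i := by
      refine (hg i hi.1 hi.2).trans ?_
      have := mul_le_mul_of_nonneg_left h1 hC.le
      have := mul_le_mul_of_nonneg_left h2 hC.le
      linarith
    calc _ ≤ (1 + (i : ℝ)) * (2 * C * (p ^ 2)⁻¹ * p ^ i) := by gcongr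
      _ = _ := by ring
  refine (Finset.sum_le_sum hterm).trans ?_
  rw [← Finset.mul_sum]
  have := hsum.sum_le_tsum (Finset.Icc r (N / 2 + 1)) fun i _ => hnn i
  have hpos : 0 < 2 * C * (p ^ 2)⁻¹ := by positivity
  have := mul_le_mul_of_nonneg_left this hpos.le
  linarith

/-! ### Assembling the periodic Gram matrix from mesh intervals -/

noncomputable section

/-- On this interval the `l`-th translate is the piece of index `n - j - l N`, so periodization
selects the pieces with `k ≡ n - j` mod `N`. -/
theorem periodicSpline_mesh (r N : ℕ) (hN : 0 < N) (n j : ℤ) (t : ℝ)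
    (ht : t ∈ Set.Ioo (0 : ℝ) 1) :
    periodicSpline (r + 1) N (j + 1) (((n : ℝ) + t) / N) =
      ∑ k : Fin (r + 1), (if (N : ℤ) ∣ n - j - ((k : ℕ) : ℤ) then 1 else 0) *
        bsplinePiece (r + 1) ((k : ℕ) : ℤ) t := by
  have hN0 : (N : ℝ) ≠ 0 := by positivity
  have hNz : (N : ℤ) ≠ 0 := by positivity
  have hterm : ∀ l : ℤ, splinePhi (r + 1) N (j + 1 + l * (N : ℤ)) (((n : ℝ) + t) / N) =
      ∑ k : Fin (r + 1), if n - j - l * N = ((k : ℕ) : ℤ) then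
        bsplinePiece (r + 1) ((k : ℕ) : ℤ) t else 0 := by
    intro l
    have h1 : splinePhi (r + 1) N (j + 1 + l * (N : ℤ)) (((n : ℝ) + t) / N) =
        bsplinePiece (r + 1) (n - j - l * N) t := by
      simp only [splinePhi, bsplinePiece]
      congr 1
      push_cast
      field_simp
      ring
    rw [h1]
    by_cases hk : n - j - l * N < 0 ∨ (r : ℤ) + 1 ≤ n - j - l * N
    · rw [bsplinePiece_eq_zero r _ hk t ht, Finset.sum_eq_zero]
      intro k _
      have := k.isLt
      rw [if_neg (by omega)]
    · obtain ⟨k, hk'⟩ := Int.eq_ofNat_of_zero_le (a := n - j - l * N) (by omega)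
      rw [Finset.sum_eq_single ⟨k, by omega⟩]
      · rw [if_pos hk', hk']
      · intro b _ hb
        rw [if_neg]
        intro h
        apply hb
        ext
        simp only
        omega
      · simp
  have hsum : HasSum (fun l : ℤ => splinePhi (r + 1) N (j + 1 + l * (N : ℤ)) (((n : ℝ) + t) / N))
      (∑ k : Fin (r + 1), (if (N : ℤ) ∣ n - j - ((k : ℕ) : ℤ) then 1 else 0) *
        bsplinePiece (r + 1) ((k : ℕ) : ℤ) t) := by
    simp only [hterm]
    refine hasSum_sum fun k _ => ?_
    split_ifs with h
    · obtain ⟨a, ha⟩ := h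
      convert hasSum_ite_eq a (bsplinePiece (r + 1) ((k : ℕ) : ℤ) t) using 2 with l
      · congr 1
        rw [eq_iff_iff]
        constructor
        · intro h
          have : (N : ℤ) * a = N * l := by linarith
          exact (mul_left_cancel₀ hNz this).symm
        · rintro rfl
          linarith
      · rw [one_mul]
    · rw [zero_mul]
      convert hasSum_zero using 2 with l
      rw [if_neg]
      intro hl
      exact h ⟨l, by linarith⟩
  exact hsum.tsum_eq

theorem natCast_mul_integral_eq_sum (N : ℕ) (hN : 0 < N) (f : ℝ → ℝ)
    (hf : ∀ n < N, IntervalIntegrable (fun t => f (((n : ℝ) + t) / N)) volume 0 1) :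
    (N : ℝ) * ∫ x in (0 : ℝ)..1, f x =
      ∑ n ∈ Finset.range N, ∫ t in (0 : ℝ)..1, f (((n : ℝ) + t) / N) := by
  have hN0 : (N : ℝ) ≠ 0 := by positivity
  have h1 : (N : ℝ) * ∫ x in (0 : ℝ)..1, f x = ∫ u in ((0 : ℕ) : ℝ)..(N : ℝ), f (u / N) := by
    rw [intervalIntegral.integral_comp_div _ hN0, Nat.cast_zero, zero_div, div_self hN0,
      smul_eq_mul]
  rw [h1, ← intervalIntegral.sum_integral_adjacent_intervals (a := fun n : ℕ => (n : ℝ))]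
  · refine Finset.sum_congr rfl fun n _ => ?_
    rw [intervalIntegral.integral_comp_add_left (fun u => f (u / N)) (n : ℝ)]
    push_cast
    rw [add_zero]
  · intro n hn
    have := (hf n hn).comp_sub_right (n : ℝ)
    convert this using 1
    · ext u
      congr 2
      ring
    · ring
    · push_cast
      ring

/-- The incidence matrix of the pieces on the `n`-th mesh interval with the periodic basis. -/
def meshIncidence (r N : ℕ) (n : ℕ) : Matrix (Fin r) (Fin N) ℝ :=
  Matrix.of fun k j => if (N : ℤ) ∣ (n : ℤ) - ((j : ℕ) : ℤ) - ((k : ℕ) : ℤ) then 1 else 0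

theorem splineGram_apply (r N : ℕ) (hN : 0 < N) (i j : Fin N) :
    splineGram (r + 2) N i j = ∑ n ∈ Finset.range N,
      (meshIncidence (r + 2) N n).col i ⬝ᵥ
        (localGram (r + 2)).mulVec ((meshIncidence (r + 2) N n).col j) := by
  have hmesh : ∀ (n : ℕ) (i : Fin N), ∀ t ∈ Set.Ioo (0 : ℝ) 1,
      periodicSpline (r + 2) N ((i : ℤ) + 1) (((n : ℝ) + t) / N) =
      ∑ k, (meshIncidence (r + 2) N n).col i k * bsplinePiece (r + 2) ((k : ℕ) : ℤ) t := by
    intro n i t ht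
    exact periodicSpline_mesh (r + 1) N hN n i t ht
  have hcont : ∀ (n : ℕ) (i : Fin N), Continuous fun t =>
      ∑ k, (meshIncidence (r + 2) N n).col i k * bsplinePiece (r + 2) ((k : ℕ) : ℤ) t :=
    fun n i => continuous_finsetSum _ fun k _ =>
      continuous_const.mul (continuous_bsplinePiece r _)
  have heq : ∀ n : ℕ, Set.EqOn (fun t =>
      (∑ k, (meshIncidence (r + 2) N n).col i k * bsplinePiece (r + 2) ((k : ℕ) : ℤ) t) *
      (∑ k, (meshIncidence (r + 2) N n).col j k * bsplinePiece (r + 2) ((k : ℕ) : ℤ) t))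
      (fun t => periodicSpline (r + 2) N ((j : ℤ) + 1) (((n : ℝ) + t) / N) *
        periodicSpline (r + 2) N ((i : ℤ) + 1) (((n : ℝ) + t) / N)) (Set.Ioo 0 1) := by
    intro n t ht
    simp only [hmesh n _ t ht]
    exact mul_comm _ _
  simp only [splineGram, Matrix.of_apply, one_div, inv_inv]
  rw [natCast_mul_integral_eq_sum N hN]
  · refine Finset.sum_congr rfl fun n _ => ?_
    rw [← integral_sum_bsplinePiece_mul, intervalIntegral.integral_of_le zero_le_one,
      intervalIntegral.integral_of_le zero_le_one, integral_Ioc_eq_integral_Ioo,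
      integral_Ioc_eq_integral_Ioo]
    exact (setIntegral_congr_fun measurableSet_Ioo (heq n)).symm
  · intro n _
    have h := ((hcont n i).mul (hcont n j)).intervalIntegrable (μ := volume) 0 1
    rw [intervalIntegrable_iff_integrableOn_Ioo_of_le zero_le_one] at h ⊢
    exact h.congr_fun (heq n) measurableSet_Ioo

theorem splineGram_isSymm (r N : ℕ) : (splineGram r N).IsSymm := by
  ext i j
  simp only [Matrix.transpose_apply, splineGram, Matrix.of_apply, mul_comm]

/-- If the two basis functions meet a common mesh interval in pieces `k` and `l`, then `i - j ≡ l -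
k` mod `N`. -/
theorem splineGram_cyclicBand (r N : ℕ) (i j : Fin N) (h : splineGram (r + 2) N i j ≠ 0) :
    ∃ d : ℤ, |d| ≤ ((r + 1 : ℕ) : ℤ) ∧ (N : ℤ) ∣ (i : ℤ) - j - d := by
  rw [splineGram_apply r N i.pos] at h
  obtain ⟨n, -, hn⟩ := Finset.exists_ne_zero_of_sum_ne_zero h
  obtain ⟨k, -, hk⟩ := Finset.exists_ne_zero_of_sum_ne_zero hn
  have hk' := right_ne_zero_of_mul hk
  simp only [Matrix.mulVec, dotProduct] at hk'
  obtain ⟨l, -, hl⟩ := Finset.exists_ne_zero_of_sum_ne_zero hk'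
  have h1 := left_ne_zero_of_mul hk
  have h2 := right_ne_zero_of_mul hl
  simp only [Matrix.col_apply, meshIncidence, Matrix.of_apply, ne_eq, ite_eq_right_iff,
    one_ne_zero, imp_false, not_not] at h1 h2
  refine ⟨(l : ℕ) - (k : ℕ), ?_, ?_⟩
  · have := k.isLt
    have := l.isLt
    rw [abs_le]
    omega
  · have := dvd_sub h2 h1
    rwa [show ((n : ℤ) - ((j : ℕ) : ℤ) - ((l : ℕ) : ℤ)) - ((n : ℤ) - ((i : ℕ) : ℤ) - ((k : ℕ) : ℤ)) =
      i - j - (((l : ℕ) : ℤ) - ((k : ℕ) : ℤ)) by ring] at this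

theorem dotProduct_splineGram_mulVec (r N : ℕ) (hN : 0 < N) (x : Fin N → ℝ) :
    x ⬝ᵥ (splineGram (r + 2) N).mulVec x = ∑ n ∈ Finset.range N,
      localForm (r + 2) ((meshIncidence (r + 2) N n).mulVec x) := by
  have hG : splineGram (r + 2) N = ∑ n ∈ Finset.range N,
      (meshIncidence (r + 2) N n).transpose * (localGram (r + 2) * meshIncidence (r + 2) N n) := by
    ext i j
    rw [splineGram_apply r N hN, Matrix.sum_apply]
    rfl
  rw [hG, Matrix.sum_mulVec, dotProduct_sum]
  refine Finset.sum_congr rfl fun n _ => ?_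
  rw [localForm_eq, ← Matrix.mulVec_mulVec, ← Matrix.mulVec_mulVec, Matrix.dotProduct_mulVec,
    Matrix.vecMul_transpose]

/-- For fixed `k`, the map `n ↦ n - k` permutes the residues mod `N`, so each of the `r` pieces
contributes `x ⬝ᵥ x`. -/
theorem sum_meshIncidence_mulVec_sq (r N : ℕ) (hN : 0 < N) (x : Fin N → ℝ) :
    ∑ n ∈ Finset.range N, ∑ k, ((meshIncidence r N n).mulVec x k) ^ 2 = r * (x ⬝ᵥ x) := by
  have : NeZero N := ⟨hN.ne'⟩
  have hmul : ∀ (n : Fin N) (k : Fin r),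
      (meshIncidence r N n).mulVec x k = x (n - Fin.ofNat N k) := by
    intro n k
    have hiff : ∀ j : Fin N, (N : ℤ) ∣ ((n : ℕ) : ℤ) - ((j : ℕ) : ℤ) - ((k : ℕ) : ℤ) ↔
        j = n - Fin.ofNat N k := by
      intro j
      rw [eq_sub_iff_add_eq, Fin.ext_iff, Fin.val_add, Fin.val_ofNat, Nat.add_mod_mod, sub_sub,
        ← Nat.cast_add, ← Nat.modEq_iff_dvd, Nat.ModEq, Nat.mod_eq_of_lt n.isLt]
    simp [Matrix.mulVec, dotProduct, meshIncidence, hiff]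
  rw [Finset.sum_range, Finset.sum_comm]
  simp only [hmul]
  have hshift : ∀ k : Fin r, ∑ n : Fin N, x (n - Fin.ofNat N k) ^ 2 = x ⬝ᵥ x := by
    intro k
    refine (Equiv.sum_comp (Equiv.subRight (Fin.ofNat N k)) fun n => x n ^ 2).trans ?_
    simp [dotProduct, sq]
  simp only [hshift, Finset.sum_const, Finset.card_univ, Fintype.card_fin, nsmul_eq_mul]

theorem exists_splineGram_bounds (r : ℕ) : ∃ m M : ℝ, 0 < m ∧ m < M ∧
    ∀ N : ℕ, 0 < N → ∀ x : Fin N → ℝ,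
      m * (x ⬝ᵥ x) ≤ x ⬝ᵥ (splineGram (r + 2) N).mulVec x ∧
      x ⬝ᵥ (splineGram (r + 2) N).mulVec x ≤ M * (x ⬝ᵥ x) := by
  obtain ⟨m, M, hm, hmM, h⟩ := exists_localForm_bounds r
  have hr : (0 : ℝ) < (r + 2 : ℕ) := by positivity
  refine ⟨m * (r + 2 : ℕ), M * (r + 2 : ℕ), by positivity,
    mul_lt_mul_of_pos_right hmM hr, ?_⟩
  intro N hN x
  rw [mul_assoc, mul_assoc, ← sum_meshIncidence_mulVec_sq (r + 2) N hN,
    dotProduct_splineGram_mulVec r N hN, Finset.mul_sum, Finset.mul_sum]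
  exact ⟨Finset.sum_le_sum fun n _ => (h _).1, Finset.sum_le_sum fun n _ => (h _).2⟩

end

theorem lemma4p2 (r : ℕ) (hr : 2 ≤ r) :
    ∃ C₁ C₂ C₃ q : ℝ, 0 < C₁ ∧ 0 < C₂ ∧ 0 < C₃ ∧ 1 < q ∧
      ∀ N : ℕ, 4 * r ≤ N →
        IsUnit (splineGram r N).det ∧
        (∀ i : ℕ, r ≤ i → i ≤ N / 2 + 1 →
          |splineGamma r N i| ≤
            C₁ * q ^ (-((i : ℤ) - 1)) + C₂ * q ^ (-((N : ℤ) - (i : ℤ)))) ∧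
        ∑ i ∈ Finset.Icc r (N / 2 + 1), (1 + (i : ℝ)) * |splineGamma r N i| ≤ C₃ := by
  obtain ⟨s, rfl⟩ : ∃ s, r = s + 2 := ⟨r - 2, by omega⟩
  obtain ⟨m, M, hm, hmM, hbound⟩ := exists_splineGram_bounds s
  obtain ⟨C, q, hC, hq, hdecay⟩ := Matrix.exists_cyclicBand_inv_decay s.succ_pos hm hmM
  obtain ⟨C₃, hC₃, hsum⟩ := exists_sum_weighted_bound hC hq
  have hq0 : 0 < q := one_pos.trans hq
  refine ⟨C, C, C₃, q, hC, hC, hC₃, hq, ?_⟩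
  intro N hN
  have hN0 : 0 < N := by omega
  have hgamma : ∀ i : ℕ, s + 2 ≤ i → i ≤ N / 2 + 1 →
      |splineGamma (s + 2) N i| ≤ C * q⁻¹ ^ (i - 1) + C * q⁻¹ ^ (N - i) := by
    intro i hi hiN
    rw [splineGamma, dif_pos ⟨by omega, by omega⟩]
    refine (hdecay N _ (splineGram_isSymm _ _) (fun x => (hbound N hN0 x).1)
      (fun x => (hbound N hN0 x).2) (splineGram_cyclicBand s N) _ _ rfl).trans ?_
    -- `γ_i` sits in column `i - 1` counted from zero, so its wrapped distance is `N - i + 1`, one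
    -- more than required.
    have : q⁻¹ ^ (N - (i - 1)) ≤ q⁻¹ ^ (N - i) :=
      pow_le_pow_of_le_one (by positivity) (inv_le_one_of_one_le₀ hq.le) (by omega)
    have := mul_le_mul_of_nonneg_left this hC.le
    simpa using this
  refine ⟨Matrix.isUnit_det_of_coercive hm fun x => (hbound N hN0 x).1, ?_,
    hsum _ N _ hr hgamma⟩
  intro i hi hiN
  have h := hgamma i hi hiN
  rw [zpow_neg, zpow_neg, show (i : ℤ) - 1 = ((i - 1 : ℕ) : ℤ) by omega,
    show (N : ℤ) - i = ((N - i : ℕ) : ℤ) by omega, zpow_natCast, zpow_natCast, ← inv_pow,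
    ← inv_pow]
  exact h
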